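/- Let $\beta>0$, $\mathcal E>0$, $\mathcal N_0>0$ and $\gamma=\mathcal E/\mathcal N_0$. For positive integers $N$ and $K$ consider the channel $\boldsymbol y=\boldsymbol S\boldsymbol b+\boldsymbol n\in\mathbb C^N$, where - $\boldsymbol S=[\boldsymbol s_1,\dots,\boldsymbol s_K]\in\mathbb R^{N\times K}$ is a random time-hopping matrix with one pulse per symbol ($N_{\mathsf s}=1$): its columns are independent and uniformly distributed on the $2N$ vectors $\pm\boldsymbol e_1,\dots,\pm\boldsymbol e_N$, with $\boldsymbol e_i$ the standard basis vectors of $\mathbb R^N$; - the inputs $b_1,\dots,b_K$ are independent circularly symmetric complex Gaussian variables with mean $0$ and variance $\mathcal E$; - the coordinates of $\boldsymbol n$ are independent circularly symmetric complex Gaussian variables with mean $0$ and variance $\mathcal N_0$; - $\boldsymbol S,\boldsymbol b,\boldsymbol n$ are independent. A linear receiver forms $\boldsymbol r=\boldsymbol W^{\mathsf T}\boldsymbol y$, and the decoder of user $k$ observes $r_k$ and knows $\boldsymbol S$. The bank of decorrelators is $\boldsymbol W^{\mathsf T}=\boldsymbol S^{+}$ (the Moore–Penrose pseudoinverse), the bank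 of MMSE filters is $\boldsymbol W^{\mathsf T}=\boldsymbol W^{\mathsf T}(1/\gamma)$, where $\boldsymbol W^{\mathsf T}(\alpha)=(\boldsymbol S^{\mathsf T}\boldsymbol S+\alpha\boldsymbol I)^{-1}\boldsymbol S^{\mathsf T}$ for $\alpha>0$, and the bank of single-user matched filters is $\boldsymbol W^{\mathsf T}=\boldsymbol S^{\mathsf T}$. Let $I(b_k;r_k|\boldsymbol S)$ denote the conditional mutual information in bits. Then for the decorrelators, for the MMSE filters, for $\boldsymbol W^{\mathsf T}(\alpha)$ with any fixed $\alpha>0$, and for the single-user matched filters, in the large-system limit $N\to\infty$, $K/N\to\beta$, and for any choice of the user $k$ (in particular for user $1$), $$\beta\, I(b_k;r_k|\boldsymbol S)\;\longrightarrow\;\beta\sum_{j\ge 0}\frac{\beta^{j}e^{-\beta}}{j!}\,\log_2\!\Big(1+\frac{\gamma}{j\gamma+1}\Big),$$ where the series converges. In particular the limiting mutual information does not depend on $\alpha$ and is the same for decorrelators, MMSE filters and matched filters. -/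

import Mathlib

open MeasureTheory ProbabilityTheory Filter Topology
open scoped ENNReal NNReal Matrix

namespace THCDMA

/-! ### Moore–Penrose pseudoinverse of a real matrix -/

/-- `X` satisfies the four Penrose equations for `A`. -/
structure IsMoorePenroseInverse {N K : ℕ} (A : Matrix (Fin N) (Fin K) ℝ)
    (X : Matrix (Fin K) (Fin N) ℝ) : Prop where
  mul_mul_self : A * X * A = A
  self_mul_mul : X * A * X = X
  left_symm : (A * X)ᵀ = A * X
  right_symm : (X * A)ᵀ = X * A

theorem IsMoorePenroseInverse.unique {N K : ℕ} {A : Matrix (Fin N) (Fin K) ℝ}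
    {X Y : Matrix (Fin K) (Fin N) ℝ} (hX : IsMoorePenroseInverse A X)
    (hY : IsMoorePenroseInverse A Y) : X = Y := by
  have h1 : A * X = A * Y := by
    calc A * X = (A * Y) * (A * X) := by rw [← Matrix.mul_assoc, hY.mul_mul_self]
      _ = ((A * X) * (A * Y))ᵀ := by rw [Matrix.transpose_mul, hX.left_symm, hY.left_symm]
      _ = A * Y := by rw [← Matrix.mul_assoc, hX.mul_mul_self, hY.left_symm]
  have h2 : X * A = Y * A := by
    calc X * A = (X * A) * (Y * A) := by
          rw [Matrix.mul_assoc, ← Matrix.mul_assoc A Y A, hY.mul_mul_self]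
      _ = ((Y * A) * (X * A))ᵀ := by rw [Matrix.transpose_mul, hX.right_symm, hY.right_symm]
      _ = Y * A := by
          rw [Matrix.mul_assoc, ← Matrix.mul_assoc A X A, hX.mul_mul_self, hY.right_symm]
  calc X = X * A * X := hX.self_mul_mul.symm
    _ = X * A * Y := by rw [Matrix.mul_assoc, h1, ← Matrix.mul_assoc]
    _ = Y := by rw [h2, hY.self_mul_mul]

theorem exists_symmetric_pseudoinverse {K : ℕ} (H : Matrix (Fin K) (Fin K) ℝ)
    (hH : H.IsHermitian) :
    ∃ Y, Yᵀ = Y ∧ H * Y = Y * H ∧ H * Y * H = H ∧ Y * H * Y = Y := by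
  have h := hH.spectral_theorem
  rw [Unitary.conjStarAlgAut_apply] at h
  obtain ⟨V, hV⟩ : ∃ V : Matrix (Fin K) (Fin K) ℝ, V = hH.eigenvectorUnitary := ⟨_, rfl⟩
  have hVV : star V * V = 1 := by rw [hV]; exact Unitary.coe_star_mul_self _
  rw [← hV] at h
  set d := hH.eigenvalues
  have hs : (star V) = Vᵀ := by
    rw [Matrix.star_eq_conjTranspose, Matrix.conjTranspose_eq_transpose_of_trivial]
  rw [hs] at hVV
  have h' : H = V * Matrix.diagonal d * Vᵀ := by rw [← hs]; exact h
  have key : ∀ P Q : Matrix (Fin K) (Fin K) ℝ,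
      (V * P * Vᵀ) * (V * Q * Vᵀ) = V * (P * Q) * Vᵀ := by
    intro P Q
    calc _ = V * P * (Vᵀ * V) * Q * Vᵀ := by simp only [Matrix.mul_assoc]
      _ = _ := by rw [hVV]; simp only [Matrix.mul_assoc, Matrix.one_mul]
  refine ⟨V * Matrix.diagonal (fun i => (d i)⁻¹) * Vᵀ, ?_, ?_, ?_, ?_⟩
  · simp [Matrix.mul_assoc]
  · rw [h', key, key]; simp [mul_comm]
  · rw [h', key, key]; simp
  · have hd : ∀ i, (d i)⁻¹ * d i * (d i)⁻¹ = (d i)⁻¹ := fun i => by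
      by_cases hi : d i = 0 <;> simp [hi]
    rw [h', key, key]; simp [hd]

theorem exists_isMoorePenroseInverse {N K : ℕ} (A : Matrix (Fin N) (Fin K) ℝ) :
    ∃ X, IsMoorePenroseInverse A X := by
  have hH : (Aᵀ * A).IsHermitian := by
    simpa using Matrix.isHermitian_conjTranspose_mul_self A
  obtain ⟨Y, hY, hc, h1, h2⟩ := exists_symmetric_pseudoinverse _ hH
  have h3 : A * Y * (Aᵀ * A) = A := by
    have : A * Y * (Aᵀ * A) - A = 0 := by
      rw [← Matrix.conjTranspose_mul_self_eq_zero, Matrix.conjTranspose_eq_transpose_of_trivial]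
      have e : Aᵀ * (A * Y * (Aᵀ * A) - A) = 0 := by
        rw [Matrix.mul_sub, sub_eq_zero, ← h1]
        simp only [Matrix.mul_assoc] at h1 ⊢
        rw [h1]
        exact h1
      have e2 : (A * Y * (Aᵀ * A) - A)ᵀ = (Aᵀ * A * Y - 1) * Aᵀ := by
        simp [hY, Matrix.sub_mul, Matrix.mul_assoc]
      rw [e2, Matrix.mul_assoc, e, Matrix.mul_zero]
    exact sub_eq_zero.mp this
  refine ⟨Y * Aᵀ, ?_, ?_, ?_, ?_⟩
  · simpa only [Matrix.mul_assoc] using h3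
  · calc Y * Aᵀ * A * (Y * Aᵀ) = (Y * (Aᵀ * A) * Y) * Aᵀ := by simp only [Matrix.mul_assoc]
      _ = Y * Aᵀ := by rw [h2]
  · simp [hY, Matrix.mul_assoc]
  · rw [Matrix.mul_assoc, ← hc]; simp [hY, hc]

/-- The Moore–Penrose pseudoinverse `A⁺`. -/
noncomputable def pinv {N K : ℕ} (A : Matrix (Fin N) (Fin K) ℝ) : Matrix (Fin K) (Fin N) ℝ :=
  Classical.choose (exists_isMoorePenroseInverse A)

/-! ### Mutual information -/

/-- Mutual information `I(X;Y)` in bits: the Kullback–Leibler divergence of the joint law from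
the product of the marginals, divided by `log 2`. -/
noncomputable def mutualInfo {Ω 𝓧 𝓨 : Type*} [MeasurableSpace Ω] [MeasurableSpace 𝓧]
    [MeasurableSpace 𝓨] (X : Ω → 𝓧) (Y : Ω → 𝓨) (μ : Measure Ω) : ℝ≥0∞ :=
  InformationTheory.klDiv (μ.map fun ω => (X ω, Y ω)) ((μ.map X).prod (μ.map Y)) /
    ENNReal.ofReal (Real.log 2)

/-- Conditional mutual information `I(X;Y|Z) = ∑ z, P(Z = z) I(X;Y|Z = z)` in bits, for a
discrete random variable `Z` (one taking almost surely countably many values). -/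
noncomputable def condMutualInfo {Ω 𝓧 𝓨 𝓩 : Type*} [MeasurableSpace Ω] [MeasurableSpace 𝓧]
    [MeasurableSpace 𝓨] (X : Ω → 𝓧) (Y : Ω → 𝓨) (Z : Ω → 𝓩) (μ : Measure Ω) : ℝ≥0∞ :=
  ∑' z : 𝓩, μ {ω | Z ω = z} * mutualInfo X Y (μ[|{ω | Z ω = z}])

/-! ### The channel -/

/-- The circularly symmetric complex Gaussian law with mean zero and variance `v`: real and
imaginary parts are independent `N(0, v/2)`. -/
noncomputable def complexGaussian (v : ℝ≥0) : Measure ℂ :=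
  ((gaussianReal 0 (v / 2)).prod (gaussianReal 0 (v / 2))).map fun p => (⟨p.1, p.2⟩ : ℂ)

/-- The time-hopping sequences of length `N` with one pulse per symbol: exactly one entry is
nonzero, and it is `1` or `-1`. -/
def thSequences (N : ℕ) : Set (Fin N → ℝ) :=
  {s | ∃ i : Fin N, s = Pi.single i 1 ∨ s = Pi.single i (-1)}

/-- The random data of the channel `y = S b + n` with `K` users and `N` chips: the columns of
`S` are independent, uniformly distributed time-hopping sequences with one pulse; the inputs are
independent `CN(0, En)`; the noise coordinates are independent `CN(0, N₀)`; and `S`, `b`, `n`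
are independent. -/
structure IsTHChannel {Ω : Type*} [MeasurableSpace Ω] (μ : Measure Ω) {N K : ℕ} (En N₀ : ℝ≥0)
    (S : Ω → Matrix (Fin N) (Fin K) ℝ) (b : Ω → Fin K → ℂ) (n : Ω → Fin N → ℂ) : Prop where
  law_col : ∀ k, HasLaw (fun ω => (S ω).col k) (uniformOn (thSequences N)) μ
  indep_col : iIndepFun (fun k ω => (S ω).col k) μ
  law_input : HasLaw b (Measure.pi fun _ => complexGaussian En) μ
  law_noise : HasLaw n (Measure.pi fun _ => complexGaussian N₀) μ
  indep_input_noise : IndepFun b n μ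
  indep_spreading : IndepFun (fun ω k => (S ω).col k) (fun ω => (b ω, n ω)) μ

/-- Output of the channel `y = S b + n`. -/
noncomputable def received {N K : ℕ} (S : Matrix (Fin N) (Fin K) ℝ) (b : Fin K → ℂ)
    (n : Fin N → ℂ) : Fin N → ℂ :=
  S.map Complex.ofReal *ᵥ b + n

/-! ### Linear receivers

A receiver assigns to the spreading matrix `S` the matrix `Wᵀ` applied to the channel output. -/

/-- Bank of single-user matched filters, `Wᵀ = Sᵀ`. -/
def sumf {N K : ℕ} (S : Matrix (Fin N) (Fin K) ℝ) : Matrix (Fin K) (Fin N) ℝ := Sᵀ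

/-- Bank of decorrelators, `Wᵀ = S⁺`. -/
noncomputable def decorrelator {N K : ℕ} (S : Matrix (Fin N) (Fin K) ℝ) :
    Matrix (Fin K) (Fin N) ℝ := pinv S

/-- The regularized linear receiver `Wᵀ(α) = (Sᵀ S + α I)⁻¹ Sᵀ`. -/
noncomputable def linearReceiver {N K : ℕ} (α : ℝ) (S : Matrix (Fin N) (Fin K) ℝ) :
    Matrix (Fin K) (Fin N) ℝ := (Sᵀ * S + α • (1 : Matrix (Fin K) (Fin K) ℝ))⁻¹ * Sᵀ

/-- Bank of MMSE filters at signal-to-noise ratio `γ`, `Wᵀ = (Sᵀ S + γ⁻¹ I)⁻¹ Sᵀ`. -/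
noncomputable def mmse {N K : ℕ} (γ : ℝ) (S : Matrix (Fin N) (Fin K) ℝ) :
    Matrix (Fin K) (Fin N) ℝ := linearReceiver (1 / γ) S

/-- `I(b_k ; r_k | S)` in bits per channel use, where `r = Wᵀ y = Wᵀ (S b + n)`: the mutual
information of user `k` when the decoder of this user observes only `r_k` and knows `S`. -/
noncomputable def userInfo {Ω : Type*} [MeasurableSpace Ω] (μ : Measure Ω) {N K : ℕ}
    (W : Matrix (Fin N) (Fin K) ℝ → Matrix (Fin K) (Fin N) ℝ)
    (S : Ω → Matrix (Fin N) (Fin K) ℝ) (b : Ω → Fin K → ℂ) (n : Ω → Fin N → ℂ)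
    (k : Fin K) : ℝ≥0∞ :=
  condMutualInfo (fun ω => b ω k)
    (fun ω => ((W (S ω)).map Complex.ofReal *ᵥ received (S ω) (b ω) (n ω)) k) S μ

/-- The `k`-th term of the series in the limiting mutual information. -/
noncomputable def poissonTerm (β γ : ℝ) (k : ℕ) : ℝ :=
  β ^ k * Real.exp (-β) / (k.factorial : ℝ) * Real.logb 2 (1 + γ / (k * γ + 1))

end THCDMA

namespace THCDMA

/-!
The chips of a time-hopping matrix `S` with one pulse per symbol do not interact: `S Sᵀ` is the
diagonal matrix of the chip loads. Hence `S⁺` and `(Sᵀ S + α I)⁻¹ Sᵀ` are `Sᵀ` times an invertible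
diagonal matrix on the occupied chips, so that each of their filters is a nonzero multiple of the
matched filter, and rescaling `r_k` does not change `I(b_k; r_k | S)`. Given `S`, user `k` sees a
Gaussian channel whose interference comes from the `j` other users sharing its chip, at the same
power, which yields `log₂ (1 + γ / (j γ + 1))` bits. Averaging over `S`, the number `j` is binomial
with `K - 1` trials of probability `1 / N`, and it converges to a Poisson variable of mean `β`; the
rates are bounded by `log₂ (1 + γ)`, so dominated convergence applies.
-/

theorem complexGaussian_eq_map (v : ℝ≥0) :
    complexGaussian v = ((gaussianReal 0 (v / 2)).prod (gaussianReal 0 (v / 2))).map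
      Complex.measurableEquivRealProd.symm := rfl

instance isProbabilityMeasure_complexGaussian (v : ℝ≥0) :
    IsProbabilityMeasure (complexGaussian v) :=
  Measure.isProbabilityMeasure_map Complex.measurableEquivRealProd.symm.measurable.aemeasurable

/-- The density of the circularly symmetric complex Gaussian law of variance `v` with respect to
Lebesgue measure on `ℂ`. -/
noncomputable def complexGaussianPDF (v : ℝ≥0) (z : ℂ) : ℝ :=
  (Real.pi * v)⁻¹ * Real.exp (-‖z‖ ^ 2 / v)

theorem measurable_complexGaussianPDF (v : ℝ≥0) : Measurable (complexGaussianPDF v) := by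
  unfold complexGaussianPDF
  fun_prop

theorem complexGaussianPDF_nonneg (v : ℝ≥0) (z : ℂ) : 0 ≤ complexGaussianPDF v z := by
  unfold complexGaussianPDF
  positivity

theorem sq_norm_measurableEquivRealProd_symm (p : ℝ × ℝ) :
    ‖Complex.measurableEquivRealProd.symm p‖ ^ 2 = p.1 ^ 2 + p.2 ^ 2 := by
  rw [Complex.sq_norm, Complex.normSq_apply, pow_two, pow_two]
  rfl

theorem gaussianPDFReal_mul_gaussianPDFReal (v : ℝ≥0) (x y : ℝ) :
    gaussianPDFReal 0 (v / 2) x * gaussianPDFReal 0 (v / 2) y =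
      complexGaussianPDF v (Complex.measurableEquivRealProd.symm (x, y)) := by
  have hscale : 2 * Real.pi * ((v / 2 : ℝ≥0) : ℝ) = Real.pi * v := by push_cast; ring
  have hvar : 2 * ((v / 2 : ℝ≥0) : ℝ) = v := by push_cast; ring
  rw [gaussianPDFReal, gaussianPDFReal, complexGaussianPDF,
    sq_norm_measurableEquivRealProd_symm, hscale, hvar, mul_mul_mul_comm, ← Real.exp_add,
    ← mul_inv, Real.mul_self_sqrt (by positivity)]
  ring_nf

theorem complexGaussian_eq_withDensity {v : ℝ≥0} (hv : v ≠ 0) :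
    complexGaussian v = volume.withDensity fun z => ENNReal.ofReal (complexGaussianPDF v z) := by
  have hpdf := (measurable_complexGaussianPDF v).ennreal_ofReal
  rw [complexGaussian_eq_map, gaussianReal_of_var_ne_zero _ (by positivity),
    prod_withDensity (measurable_gaussianPDF _ _) (measurable_gaussianPDF _ _)]
  refine Measure.ext_of_lintegral _ fun f hf => ?_
  rw [lintegral_map hf (MeasurableEquiv.measurable _),
    lintegral_withDensity_eq_lintegral_mul _ (by fun_prop) (by fun_prop),
    lintegral_withDensity_eq_lintegral_mul _ hpdf hf,
    ← Complex.volume_preserving_equiv_real_prod.symm.lintegral_comp (hpdf.mul hf),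
    ← Measure.volume_eq_prod]
  refine lintegral_congr fun p => ?_
  simp only [Pi.mul_apply, gaussianPDF]
  rw [← ENNReal.ofReal_mul (gaussianPDFReal_nonneg _ _ _), gaussianPDFReal_mul_gaussianPDFReal]

theorem charFun_complexGaussian (v : ℝ≥0) (t : ℂ) :
    charFun (complexGaussian v) t = Complex.exp (-(v * ‖t‖ ^ 2 / 4 : ℝ)) := by
  have hsplit (p : ℝ × ℝ) :
      Complex.exp ((inner ℝ (Complex.measurableEquivRealProd.symm p) t : ℝ) * Complex.I) =
        Complex.exp ((inner ℝ p.1 t.re : ℝ) * Complex.I) *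
          Complex.exp ((inner ℝ p.2 t.im : ℝ) * Complex.I) := by
    rw [← Complex.exp_add]
    simp [Complex.inner]
    ring_nf
  rw [complexGaussian_eq_map, charFun_apply, integral_map_equiv]
  simp_rw [hsplit]
  rw [integral_prod_mul (fun x : ℝ => Complex.exp ((inner ℝ x t.re : ℝ) * Complex.I))
    (fun x : ℝ => Complex.exp ((inner ℝ x t.im : ℝ) * Complex.I)), ← charFun_apply,
    ← charFun_apply, charFun_gaussianReal, charFun_gaussianReal, ← Complex.exp_add,
    Complex.sq_norm, Complex.normSq_apply]
  push_cast
  ring_nf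

theorem integrable_sq_norm_complexGaussian (v : ℝ≥0) :
    Integrable (fun z => ‖z‖ ^ 2) (complexGaussian v) := by
  have hsq : Integrable (fun x : ℝ => x ^ 2) (gaussianReal 0 (v / 2)) :=
    (memLp_id_gaussianReal 2).integrable_sq
  rw [complexGaussian_eq_map, integrable_map_equiv]
  refine ((hsq.comp_fst _).add (hsq.comp_snd _)).congr (ae_of_all _ fun p => ?_)
  exact (sq_norm_measurableEquivRealProd_symm p).symm

theorem integral_sq_norm_complexGaussian (v : ℝ≥0) : ∫ z, ‖z‖ ^ 2 ∂complexGaussian v = v := by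
  have hsq : Integrable (fun x : ℝ => x ^ 2) (gaussianReal 0 (v / 2)) :=
    (memLp_id_gaussianReal 2).integrable_sq
  have hvar : ∫ x, x ^ 2 ∂gaussianReal 0 (v / 2) = v / 2 := by
    have := variance_fun_id_gaussianReal (μ := 0) (v := v / 2)
    rw [variance_eq_integral measurable_id'.aemeasurable] at this
    simpa using this
  rw [complexGaussian_eq_map, integral_map_equiv]
  simp_rw [sq_norm_measurableEquivRealProd_symm]
  rw [integral_add (hsq.comp_fst _) (hsq.comp_snd _), integral_fun_fst (fun x : ℝ => x ^ 2),
    integral_fun_snd (fun x : ℝ => x ^ 2), hvar]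
  simp

theorem complexGaussian_map_const_mul (a : ℂ) (v : ℝ≥0) :
    (complexGaussian v).map (a * ·) = complexGaussian (‖a‖₊ ^ 2 * v) := by
  have : IsProbabilityMeasure ((complexGaussian v).map (a * ·)) :=
    Measure.isProbabilityMeasure_map (by fun_prop)
  refine Measure.ext_of_charFun (funext fun t => ?_)
  have hadj (z : ℂ) : inner ℝ (a * z) t = inner ℝ z (starRingEnd ℂ a * t) := by
    simp [Complex.inner]
    ring
  calc charFun ((complexGaussian v).map (a * ·)) t
      = charFun (complexGaussian v) (starRingEnd ℂ a * t) := by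
        rw [charFun_apply, charFun_apply, integral_map (by fun_prop) (by fun_prop)]
        simp_rw [hadj]
    _ = charFun (complexGaussian (‖a‖₊ ^ 2 * v)) t := by
        rw [charFun_complexGaussian, charFun_complexGaussian, norm_mul, Complex.norm_conj]
        push_cast
        ring_nf

section Independent

variable {Ω : Type*} [MeasurableSpace Ω] {μ : Measure Ω}

theorem hasLaw_sum_complexGaussian {ι : Type*} {ξ : ι → Ω → ℂ} {v : ι → ℝ≥0}
    (hξ : iIndepFun ξ μ) (hlaw : ∀ j, HasLaw (ξ j) (complexGaussian (v j)) μ) (s : Finset ι) :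
    HasLaw (fun ω => ∑ j ∈ s, ξ j ω) (complexGaussian (∑ j ∈ s, v j)) μ where
  aemeasurable := Finset.aemeasurable_fun_sum s fun j _ => (hlaw j).aemeasurable
  map_eq := by
    have hmeas (j : ι) : AEMeasurable (ξ j) μ := (hlaw j).aemeasurable
    have := hξ.isProbabilityMeasure
    have : IsProbabilityMeasure (μ.map fun ω => ∑ j ∈ s, ξ j ω) :=
      Measure.isProbabilityMeasure_map (Finset.aemeasurable_fun_sum s fun j _ => hmeas j)
    refine Measure.ext_of_charFun (funext fun t => ?_)
    rw [(hξ.restrict s).charFun_map_fun_finsetSum_eq_prod fun j _ => hmeas j, Finset.prod_apply]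
    simp_rw [(hlaw _).map_eq, charFun_complexGaussian]
    rw [← Complex.exp_sum]
    push_cast
    rw [Finset.sum_neg_distrib, Finset.sum_mul, Finset.sum_div]

theorem hasLaw_linearCombination_complexGaussian {ι : Type*} {ξ : ι → Ω → ℂ} {v : ι → ℝ≥0}
    (hξ : iIndepFun ξ μ) (hlaw : ∀ j, HasLaw (ξ j) (complexGaussian (v j)) μ) (a : ι → ℂ)
    (s : Finset ι) :
    HasLaw (fun ω => ∑ j ∈ s, a j * ξ j ω) (complexGaussian (∑ j ∈ s, ‖a j‖₊ ^ 2 * v j)) μ :=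
  hasLaw_sum_complexGaussian (hξ.comp (fun j => (a j * ·)) fun _ => by fun_prop)
    (fun j => HasLaw.comp
      ⟨by fun_prop, complexGaussian_map_const_mul (a j) (v j)⟩ (hlaw j)) s

end Independent

theorem klDiv_withDensity_exp {α : Type*} [MeasurableSpace α] {μ ν : Measure α}
    [IsProbabilityMeasure μ] [IsProbabilityMeasure ν] {g : α → ℝ} (hg : Measurable g)
    (hμ : μ = ν.withDensity fun x => ENNReal.ofReal (Real.exp (g x))) (hint : Integrable g μ) :
    InformationTheory.klDiv μ ν = ENNReal.ofReal (∫ x, g x ∂μ) := by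
  have hac : μ ≪ ν := hμ ▸ withDensity_absolutelyContinuous _ _
  have hderiv : μ.rnDeriv ν =ᵐ[ν] fun x => ENNReal.ofReal (Real.exp (g x)) := by
    rw [hμ]
    exact Measure.rnDeriv_withDensity _ (by fun_prop)
  have hllr : llr μ ν =ᵐ[μ] g := by
    filter_upwards [hac.ae_le hderiv] with x hx
    rw [llr, hx, ENNReal.toReal_ofReal (Real.exp_pos _).le, Real.log_exp]
  rw [InformationTheory.klDiv_of_ac_of_integrable hac (hint.congr hllr.symm),
    integral_congr_ae hllr]
  simp

/-- The log-likelihood ratio of the law `CN(c, w)` against the law `CN(0, v)` at `y`. With `c` the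
noiseless output, it is the information density of an additive Gaussian channel with noise power `w`
and output power `v`. -/
noncomputable def gaussianLogRatio (v w : ℝ≥0) (c y : ℂ) : ℝ :=
  Real.log (v / w) - ‖y - c‖ ^ 2 / w + ‖y‖ ^ 2 / v

theorem complexGaussianPDF_sub {v w : ℝ≥0} (hv : v ≠ 0) (hw : w ≠ 0) (c y : ℂ) :
    complexGaussianPDF w (y - c) =
      complexGaussianPDF v y * Real.exp (gaussianLogRatio v w c y) := by
  have : (0 : ℝ) < v := by positivity
  have : (0 : ℝ) < w := by positivity
  rw [complexGaussianPDF, complexGaussianPDF, gaussianLogRatio, Real.exp_add, Real.exp_sub,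
    Real.exp_log (by positivity), neg_div, Real.exp_neg, neg_div, Real.exp_neg]
  field_simp

section Moments

variable {Ω : Type*} [MeasurableSpace Ω] {μ : Measure Ω} {v w : ℝ≥0} {Z : Ω → ℂ}

theorem integrable_sq_norm_of_hasLaw (hZ : HasLaw Z (complexGaussian v) μ) :
    Integrable (fun ω => ‖Z ω‖ ^ 2) μ :=
  (hZ.map_eq ▸ integrable_sq_norm_complexGaussian v).comp_aemeasurable hZ.aemeasurable

theorem integral_sq_norm_of_hasLaw (hZ : HasLaw Z (complexGaussian v) μ) :
    ∫ ω, ‖Z ω‖ ^ 2 ∂μ = v :=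
  (hZ.integral_comp (f := fun z => ‖z‖ ^ 2) (by fun_prop)).trans
    (integral_sq_norm_complexGaussian v)

variable [IsProbabilityMeasure μ] {C : Ω → ℂ}

theorem integrable_gaussianLogRatio (hZ : HasLaw Z (complexGaussian w) μ)
    (hY : HasLaw (fun ω => C ω + Z ω) (complexGaussian v) μ) :
    Integrable (fun ω => gaussianLogRatio v w (C ω) (C ω + Z ω)) μ := by
  simp only [gaussianLogRatio, add_sub_cancel_left]
  exact ((integrable_const _).sub ((integrable_sq_norm_of_hasLaw hZ).div_const _)).add
    ((integrable_sq_norm_of_hasLaw hY).div_const _)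

theorem integral_gaussianLogRatio (hv : v ≠ 0) (hw : w ≠ 0) (hZ : HasLaw Z (complexGaussian w) μ)
    (hY : HasLaw (fun ω => C ω + Z ω) (complexGaussian v) μ) :
    ∫ ω, gaussianLogRatio v w (C ω) (C ω + Z ω) ∂μ = Real.log (v / w) := by
  have hnoise := (integrable_sq_norm_of_hasLaw hZ).div_const (w : ℝ)
  have houtput := (integrable_sq_norm_of_hasLaw hY).div_const (v : ℝ)
  simp only [gaussianLogRatio, add_sub_cancel_left]
  rw [integral_add (by fun_prop) houtput, integral_sub (integrable_const _) hnoise, integral_div,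
    integral_div, integral_sq_norm_of_hasLaw hZ, integral_sq_norm_of_hasLaw hY,
    div_self (by positivity), div_self (by positivity)]
  simp

end Moments

section AdditiveNoise

variable {𝓧 : Type*} [MeasurableSpace 𝓧] {f : 𝓧 → ℂ} {v w : ℝ≥0}

theorem measurable_gaussianLogRatio (hf : Measurable f) (v w : ℝ≥0) :
    Measurable fun p : 𝓧 × ℂ => gaussianLogRatio v w (f p.1) p.2 := by
  unfold gaussianLogRatio
  fun_prop

theorem prod_complexGaussian_map_add (hf : Measurable f) (hv : v ≠ 0) (hw : w ≠ 0)
    (ρ : Measure 𝓧) :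
    (ρ.prod (complexGaussian w)).map (fun p => (p.1, f p.1 + p.2)) =
      (ρ.prod (complexGaussian v)).withDensity
        fun p => ENNReal.ofReal (Real.exp (gaussianLogRatio v w (f p.1) p.2)) := by
  have hratio := measurable_gaussianLogRatio hf v w
  refine Measure.ext_of_lintegral _ fun g hg => ?_
  rw [lintegral_map hg (by fun_prop), lintegral_prod _ (by fun_prop),
    lintegral_withDensity_eq_lintegral_mul _ (by fun_prop) hg, lintegral_prod _ (by fun_prop)]
  refine lintegral_congr fun x => ?_
  rw [complexGaussian_eq_withDensity hw, complexGaussian_eq_withDensity hv,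
    lintegral_withDensity_eq_lintegral_mul _ (measurable_complexGaussianPDF w).ennreal_ofReal
      (by fun_prop),
    lintegral_withDensity_eq_lintegral_mul _ (measurable_complexGaussianPDF v).ennreal_ofReal
      (by fun_prop),
    ← lintegral_sub_right_eq_self _ (f x)]
  refine lintegral_congr fun y => ?_
  simp only [Pi.mul_apply, add_sub_cancel]
  rw [complexGaussianPDF_sub hv hw, ENNReal.ofReal_mul (complexGaussianPDF_nonneg v y), mul_assoc]

variable {Ω : Type*} [MeasurableSpace Ω] {μ : Measure Ω} [IsProbabilityMeasure μ]

-- The mutual information is the mean of the log-likelihood ratio, which depends on the noise and on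
-- the output only through their powers.
theorem mutualInfo_add_complexGaussian {X : Ω → 𝓧} {Z : Ω → ℂ} (hX : AEMeasurable X μ)
    (hf : Measurable f) (hv : v ≠ 0) (hw : w ≠ 0) (hXZ : X ⟂ᵢ[μ] Z)
    (hZ : HasLaw Z (complexGaussian w) μ)
    (hY : HasLaw (fun ω => f (X ω) + Z ω) (complexGaussian v) μ) :
    mutualInfo X (fun ω => f (X ω) + Z ω) μ = ENNReal.ofReal (Real.logb 2 (v / w)) := by
  have hXY : AEMeasurable (fun ω => (X ω, f (X ω) + Z ω)) μ := hX.prodMk hY.aemeasurable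
  have := Measure.isProbabilityMeasure_map hX
  have := Measure.isProbabilityMeasure_map hXY
  have hratio := measurable_gaussianLogRatio hf v w
  have hjoint : μ.map (fun ω => (X ω, f (X ω) + Z ω)) =
      ((μ.map X).prod (complexGaussian v)).withDensity
        fun p => ENNReal.ofReal (Real.exp (gaussianLogRatio v w (f p.1) p.2)) := by
    rw [← prod_complexGaussian_map_add hf hv hw, ← hZ.map_eq,
      ← (indepFun_iff_map_prod_eq_prod_map_map hX hZ.aemeasurable).mp hXZ,
      AEMeasurable.map_map_of_aemeasurable (by fun_prop) (hX.prodMk hZ.aemeasurable)]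
    rfl
  rw [mutualInfo, hY.map_eq, klDiv_withDensity_exp hratio hjoint
      ((integrable_map_measure hratio.aestronglyMeasurable hXY).mpr
        (integrable_gaussianLogRatio hZ hY)),
    integral_map hXY hratio.aestronglyMeasurable, integral_gaussianLogRatio hv hw hZ hY, Real.logb,
    ENNReal.ofReal_div_of_pos (Real.log_pos one_lt_two)]

end AdditiveNoise

section LinearCombination

variable {Ω ι : Type*} [MeasurableSpace Ω] {μ : Measure Ω} {ξ : ι → Ω → ℂ}

theorem indepFun_linearCombination_of_notMem (hξ : iIndepFun ξ μ)
    (hmeas : ∀ j, AEMeasurable (ξ j) μ) (a : ι → ℂ) {s : Finset ι} {u : ι} (hu : u ∉ s) :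
    ξ u ⟂ᵢ[μ] fun ω => ∑ j ∈ s, a j * ξ j ω := by
  have heval : Measurable fun x : ({u} : Finset ι) → ℂ => x ⟨u, Finset.mem_singleton_self u⟩ :=
    measurable_pi_apply _
  have hcomb : Measurable fun x : s → ℂ => ∑ j : s, a j * x j := by fun_prop
  have hind := (hξ.indepFun_finset₀ {u} s (by simpa using hu) hmeas).comp heval hcomb
  have hsum : ((fun x : s → ℂ => ∑ j : s, a j * x j) ∘ fun ω (j : s) => ξ j ω) =
      fun ω => ∑ j ∈ s, a j * ξ j ω :=
    funext fun ω => Finset.sum_coe_sort s fun j => a j * ξ j ω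
  rwa [hsum] at hind

theorem mutualInfo_linearCombination [Fintype ι] [DecidableEq ι] {v : ι → ℝ≥0}
    (hξ : iIndepFun ξ μ) (hlaw : ∀ j, HasLaw (ξ j) (complexGaussian (v j)) μ)
    (a : ι → ℂ) (u : ι) (hw : ∑ j ∈ Finset.univ.erase u, ‖a j‖₊ ^ 2 * v j ≠ 0) :
    mutualInfo (ξ u) (fun ω => ∑ j, a j * ξ j ω) μ = ENNReal.ofReal (Real.logb 2
      (1 + ‖a u‖ ^ 2 * v u / ∑ j ∈ Finset.univ.erase u, ‖a j‖ ^ 2 * v j)) := by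
  have := hξ.isProbabilityMeasure
  have hsum (ω : Ω) :=
    (Finset.add_sum_erase _ (fun j => a j * ξ j ω) (Finset.mem_univ u)).symm
  have hvar := (Finset.add_sum_erase _ (fun j => ‖a j‖₊ ^ 2 * v j) (Finset.mem_univ u)).symm
  have hY := hasLaw_linearCombination_complexGaussian hξ hlaw a Finset.univ
  simp only [hsum, hvar] at hY ⊢
  rw [mutualInfo_add_complexGaussian (f := (a u * ·)) (hlaw u).aemeasurable (by fun_prop)
    (by positivity) hw
    (indepFun_linearCombination_of_notMem hξ (fun j => (hlaw j).aemeasurable) a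
      (Finset.notMem_erase u _))
    (hasLaw_linearCombination_complexGaussian hξ hlaw a _) hY, NNReal.coe_add, add_div,
    div_self (NNReal.coe_ne_zero.mpr hw), add_comm]
  push_cast
  rfl

end LinearCombination

section Binomial

/-- The weight of `k` under the binomial law with `n` trials of success probability `x`. -/
noncomputable def binomialWeight (n : ℕ) (x : ℝ) (k : ℕ) : ℝ :=
  n.choose k * x ^ k * (1 - x) ^ (n - k)

theorem tsum_binomialWeight_mul (n : ℕ) (x : ℝ) (F : ℕ → ℝ) :
    ∑' k, binomialWeight n x k * F k =
      ∑ k ∈ Finset.range (n + 1), binomialWeight n x k * F k := by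
  refine tsum_eq_sum fun k hk => ?_
  rw [binomialWeight, Nat.choose_eq_zero_of_lt (by simpa using hk)]
  simp only [Nat.cast_zero, zero_mul]

theorem binomialWeight_nonneg {x : ℝ} (h0 : 0 ≤ x) (h1 : x ≤ 1) (n k : ℕ) :
    0 ≤ binomialWeight n x k := by
  have := sub_nonneg.mpr h1
  rw [binomialWeight]
  positivity

theorem binomialWeight_le {x : ℝ} (h0 : 0 ≤ x) (h1 : x ≤ 1) (n k : ℕ) :
    binomialWeight n x k ≤ (n * x) ^ k / k.factorial :=
  calc binomialWeight n x k ≤ n.choose k * x ^ k :=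
        mul_le_of_le_one_right (by positivity)
          (pow_le_one₀ (sub_nonneg.mpr h1) (sub_le_self 1 h0))
    _ ≤ (n : ℝ) ^ k / k.factorial * x ^ k := by
        gcongr
        exact Nat.choose_le_pow_div k n
    _ = (n * x) ^ k / k.factorial := by rw [mul_pow, div_mul_eq_mul_div]

variable {κ X : Type*} [Fintype κ] [DecidableEq κ] [Fintype X] (P : X → Prop) [DecidablePred P]

theorem card_filter_preimage_eq (A : Finset κ) :
    (Finset.univ.filter fun g : κ → X => (Finset.univ.filter fun j => P (g j)) = A).card =
      (Finset.univ.filter P).card ^ A.card *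
        (Finset.univ.filter fun x => ¬ P x).card ^ (Fintype.card κ - A.card) := by
  have hpi : (Finset.univ.filter fun g : κ → X => (Finset.univ.filter fun j => P (g j)) = A) =
      Fintype.piFinset fun j => if j ∈ A then Finset.univ.filter P
        else Finset.univ.filter fun x => ¬ P x := by
    ext g
    simp only [Finset.mem_filter_univ, Fintype.mem_piFinset, Finset.ext_iff]
    refine forall_congr' fun j => ?_
    split_ifs with hj <;> simp [hj]
  rw [hpi, Fintype.card_piFinset]
  simp only [apply_ite Finset.card]
  rw [Finset.prod_ite, Finset.prod_const, Finset.prod_const, Finset.filter_univ_mem,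
    ← Finset.card_compl]
  congr 3
  ext j
  simp

theorem sum_apply_card_filter (F : ℕ → ℝ) :
    ∑ g : κ → X, F (Finset.univ.filter fun j => P (g j)).card =
      ∑ k ∈ Finset.range (Fintype.card κ + 1), (Fintype.card κ).choose k *
        ((Finset.univ.filter P).card ^ k *
          (Finset.univ.filter fun x => ¬ P x).card ^ (Fintype.card κ - k) * F k) := by
  rw [← Finset.sum_fiberwise Finset.univ fun g : κ → X => Finset.univ.filter fun j => P (g j)]
  have hfiber (A : Finset κ) :
      ∑ g : κ → X with (Finset.univ.filter fun j => P (g j)) = A,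
        F (Finset.univ.filter fun j => P (g j)).card =
      (Finset.univ.filter P).card ^ A.card *
        (Finset.univ.filter fun x => ¬ P x).card ^ (Fintype.card κ - A.card) * F A.card := by
    rw [Finset.sum_congr rfl fun g hg => by rw [(Finset.mem_filter.mp hg).2], Finset.sum_const,
      card_filter_preimage_eq, nsmul_eq_mul]
    push_cast
    rfl
  simp_rw [hfiber]
  rw [← Finset.powerset_univ, Finset.sum_powerset_apply_card fun k =>
    ((Finset.univ.filter P).card ^ k *
      (Finset.univ.filter fun x => ¬ P x).card ^ (Fintype.card κ - k) * F k : ℝ)]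
  simp only [nsmul_eq_mul, Finset.card_univ]

theorem average_apply_card_filter [Nonempty X] (F : ℕ → ℝ) :
    (Fintype.card X : ℝ)⁻¹ ^ Fintype.card κ *
        ∑ g : κ → X, F (Finset.univ.filter fun j => P (g j)).card =
      ∑' k, binomialWeight (Fintype.card κ) ((Finset.univ.filter P).card / Fintype.card X) k *
        F k := by
  rw [sum_apply_card_filter, tsum_binomialWeight_mul, Finset.mul_sum]
  refine Finset.sum_congr rfl fun k hk => ?_
  have hcard : ((Finset.univ.filter fun x => ¬ P x).card : ℝ) / Fintype.card X =
      1 - (Finset.univ.filter P).card / Fintype.card X := by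
    have hadd := Finset.card_filter_add_card_filter_not (s := Finset.univ) P
    rw [eq_sub_iff_add_eq', ← add_div, ← Nat.cast_add, hadd, Finset.card_univ, div_self (by simp)]
  obtain ⟨l, hl⟩ := Nat.exists_eq_add_of_le (Finset.mem_range_succ_iff.mp hk)
  rw [binomialWeight, ← hcard, hl, Nat.add_sub_cancel_left, div_pow, div_pow, inv_pow, pow_add]
  field_simp

end Binomial

section PoissonLimit

variable {ι : Type*} {l : Filter ι} {n : ι → ℕ} {x : ι → ℝ} {r : ℝ}

theorem tendsto_choose_mul_pow (hr : Tendsto (fun i => n i * x i) l (𝓝 r))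
    (hx : Tendsto x l (𝓝 0)) (k : ℕ) :
    Tendsto (fun i => (n i).choose k * x i ^ k) l (𝓝 (r ^ k / k.factorial)) := by
  induction k with
  | zero => simpa using tendsto_const_nhds
  | succ k ih =>
    have hstep : Tendsto (fun i => (n i - k) * x i) l (𝓝 r) := by
      simpa [sub_mul] using hr.sub (hx.const_mul (k : ℝ))
    have hrec (i : ι) : ((n i).choose (k + 1) : ℝ) * x i ^ (k + 1) =
        (n i).choose k * x i ^ k * ((n i - k) * x i) / (k + 1) := by
      have hchoose : ((n i).choose (k + 1) : ℝ) * (k + 1) = (n i).choose k * (n i - k) := by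
        rcases le_or_gt k (n i) with hk | hk
        · rw [← Nat.cast_sub hk]
          exact_mod_cast (n i).choose_succ_right_eq k
        · simp [Nat.choose_eq_zero_of_lt hk, Nat.choose_eq_zero_of_lt (hk.trans k.lt_succ_self)]
      rw [eq_div_iff (by positivity), mul_right_comm, hchoose]
      ring
    have hlimit : r ^ k / k.factorial * r / (k + 1) = r ^ (k + 1) / (k + 1).factorial := by
      rw [Nat.factorial_succ, Nat.cast_mul, Nat.cast_succ, pow_succ]
      field_simp
    rw [← hlimit]
    exact ((ih.mul hstep).div_const _).congr fun i => (hrec i).symm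

theorem tendsto_one_sub_pow (hr : Tendsto (fun i => n i * x i) l (𝓝 r))
    (hx : Tendsto x l (𝓝 0)) :
    Tendsto (fun i => (1 - x i) ^ n i) l (𝓝 (Real.exp (-r))) := by
  have hderiv : HasDerivAt (fun y => Real.log (1 - y)) (-1) 0 := by
    simpa using ((hasDerivAt_id (0 : ℝ)).const_sub 1).log (by simp)
  have hslope : Tendsto (fun i => dslope (fun y => Real.log (1 - y)) 0 (x i)) l (𝓝 (-1)) := by
    rw [← hderiv.deriv, ← dslope_same]
    exact (continuousAt_dslope_same.mpr hderiv.differentiableAt).tendsto.comp hx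
  have hlog : Tendsto (fun i => n i * Real.log (1 - x i)) l (𝓝 (-r)) := by
    rw [← mul_neg_one]
    refine (hr.mul hslope).congr fun i => ?_
    have h := sub_smul_dslope (fun y => Real.log (1 - y)) 0 (x i)
    simp only [sub_zero, smul_eq_mul, Real.log_one] at h
    rw [mul_assoc, h]
  refine ((Real.continuous_exp.tendsto _).comp hlog).congr' ?_
  filter_upwards [hx.eventually_lt_const one_pos] with i hi
  rw [Function.comp_apply, Real.exp_nat_mul, Real.exp_log (sub_pos.mpr hi)]

theorem tendsto_binomialWeight (hr : Tendsto (fun i => n i * x i) l (𝓝 r))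
    (hx : Tendsto x l (𝓝 0)) (k : ℕ) :
    Tendsto (fun i => binomialWeight (n i) (x i) k) l
      (𝓝 (r ^ k * Real.exp (-r) / k.factorial)) := by
  have hpow : Tendsto (fun i => (1 - x i) ^ k) l (𝓝 1) := by
    simpa using (hx.const_sub 1).pow k
  have h := (tendsto_choose_mul_pow hr hx k).mul ((tendsto_one_sub_pow hr hx).div hpow one_ne_zero)
  rw [div_one, ← mul_div_right_comm] at h
  refine h.congr' ?_
  filter_upwards [hx.eventually_lt_const one_pos] with i hi
  rcases le_or_gt k (n i) with hk | hk
  · rw [binomialWeight, pow_sub₀ _ (sub_pos.mpr hi).ne' hk, Pi.div_apply, div_eq_mul_inv]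
  · simp [binomialWeight, Nat.choose_eq_zero_of_lt hk]

theorem tendsto_tsum_binomialWeight_mul {F : ℕ → ℝ} {C : ℝ} (hF : ∀ k, |F k| ≤ C)
    (hr : Tendsto (fun i => n i * x i) l (𝓝 r)) (hx : Tendsto x l (𝓝 0))
    (hx0 : ∀ᶠ i in l, 0 ≤ x i) :
    Tendsto (fun i => ∑' k, binomialWeight (n i) (x i) k * F k) l
      (𝓝 (∑' k, r ^ k * Real.exp (-r) / k.factorial * F k)) := by
  refine tendsto_tsum_of_dominated_convergence
    ((Real.summable_pow_div_factorial (r + 1)).mul_right C)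
    (fun k => (tendsto_binomialWeight hr hx k).mul_const (F k)) ?_
  filter_upwards [hx0, hx.eventually_le_const one_pos, hr.eventually_le_const (lt_add_one r)]
    with i hi0 hi1 hir k
  have hweight : binomialWeight (n i) (x i) k ≤ (r + 1) ^ k / k.factorial := by
    refine (binomialWeight_le hi0 hi1 (n i) k).trans ?_
    gcongr
  rw [norm_mul, Real.norm_of_nonneg (binomialWeight_nonneg hi0 hi1 (n i) k), Real.norm_eq_abs]
  exact mul_le_mul hweight (hF k) (abs_nonneg _)
    ((binomialWeight_nonneg hi0 hi1 (n i) k).trans hweight)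

end PoissonLimit

section HasLaw

variable {Ω 𝓧 𝓨 : Type*} [MeasurableSpace Ω] [MeasurableSpace 𝓧] [MeasurableSpace 𝓨]
  {μ : Measure Ω}

theorem hasLaw_cond_of_indepFun [IsFiniteMeasure μ] {X : Ω → 𝓧} {Y : Ω → 𝓨} {ν : Measure 𝓨}
    (hXY : X ⟂ᵢ[μ] Y) (hY : HasLaw Y ν μ) {s : Set 𝓧} (hs : MeasurableSet s)
    (hs0 : μ (X ⁻¹' s) ≠ 0) : HasLaw Y ν (μ[|X ⁻¹' s]) where
  aemeasurable := hY.aemeasurable.mono_ac cond_absolutelyContinuous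
  map_eq := by
    ext t ht
    have hnull : NullMeasurableSet (Y ⁻¹' t) (μ.restrict (X ⁻¹' s)) :=
      hY.aemeasurable.restrict.nullMeasurableSet_preimage ht
    rw [Measure.map_apply_of_aemeasurable (hY.aemeasurable.mono_ac cond_absolutelyContinuous) ht,
      ← hY.map_eq, Measure.map_apply_of_aemeasurable hY.aemeasurable ht, ProbabilityTheory.cond,
      Measure.smul_apply, Measure.restrict_apply₀ hnull,
      Set.inter_comm, hXY.measure_inter_preimage_eq_mul _ _ hs ht, smul_eq_mul, ← mul_assoc,
      ENNReal.inv_mul_cancel hs0 (measure_ne_top _ _), one_mul]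

theorem hasLaw_sumElim {ι κ : Type*} [Fintype ι] [Fintype κ] {X : Ω → ι → 𝓧} {Y : Ω → κ → 𝓧}
    {ρ : ι ⊕ κ → Measure 𝓧} [∀ i, SigmaFinite (ρ i)]
    (h : HasLaw (fun ω => (X ω, Y ω))
      ((Measure.pi fun i => ρ (.inl i)).prod (Measure.pi fun j => ρ (.inr j))) μ) :
    HasLaw (fun ω => Sum.elim (X ω) (Y ω)) (Measure.pi ρ) μ := by
  refine ((measurePreserving_sumPiEquivProdPi_symm ρ).fun_comp_hasLaw h).congr (.of_forall ?_)
  intro ω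
  ext (i | j) <;> rfl

theorem hasLaw_eval_of_hasLaw_pi {ι : Type*} [Fintype ι] {ξ : ι → Ω → 𝓧} {ρ : ι → Measure 𝓧}
    [∀ i, IsProbabilityMeasure (ρ i)] (h : HasLaw (fun ω i => ξ i ω) (Measure.pi ρ) μ) (i : ι) :
    HasLaw (ξ i) (ρ i) μ :=
  (measurePreserving_eval ρ i).fun_comp_hasLaw h

theorem iIndepFun_of_hasLaw_pi {ι : Type*} [Fintype ι] {ξ : ι → Ω → 𝓧} {ρ : ι → Measure 𝓧}
    [∀ i, IsProbabilityMeasure (ρ i)] (h : HasLaw (fun ω i => ξ i ω) (Measure.pi ρ) μ) :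
    iIndepFun ξ μ :=
  have := h.isProbabilityMeasure
  (iIndepFun_iff_hasLaw_pi_pi (hasLaw_eval_of_hasLaw_pi h)).mpr h

theorem mutualInfo_congr_right {X : Ω → 𝓧} {Y Y' : Ω → 𝓨} (h : Y =ᵐ[μ] Y') :
    mutualInfo X Y μ = mutualInfo X Y' μ := by
  have hpair : (fun ω => (X ω, Y ω)) =ᵐ[μ] fun ω => (X ω, Y' ω) :=
    h.mono fun ω hω => congrArg (Prod.mk (X ω)) hω
  rw [mutualInfo, mutualInfo, Measure.map_congr h, Measure.map_congr hpair]

end HasLaw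

section Gram

variable {m n : Type*} [Fintype n]

theorem eq_sum_sq_of_mul_transpose_eq_diagonal [DecidableEq m] {A : Matrix m n ℝ} {d : m → ℝ}
    (hA : A * Aᵀ = Matrix.diagonal d) (i : m) :
    d i = ∑ k, A i k ^ 2 := by
  rw [← Matrix.diagonal_apply_eq d i, ← hA, Matrix.mul_apply]
  simp only [Matrix.transpose_apply, pow_two]

theorem nonneg_of_mul_transpose_eq_diagonal [DecidableEq m] {A : Matrix m n ℝ} {d : m → ℝ}
    (hA : A * Aᵀ = Matrix.diagonal d) (i : m) :
    0 ≤ d i := by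
  rw [eq_sum_sq_of_mul_transpose_eq_diagonal hA]
  positivity

theorem isUnit_gram_add_smul_one [Fintype m] [DecidableEq n] (A : Matrix m n ℝ)
    {α : ℝ} (hα : 0 < α) :
    IsUnit (Aᵀ * A + α • (1 : Matrix n n ℝ)) := by
  have hgram : (Aᵀ * A).PosSemidef := by
    simpa using Matrix.posSemidef_conjTranspose_mul_self A
  exact (Matrix.PosDef.posSemidef_add hgram (Matrix.PosDef.one.smul hα)).isUnit

end Gram

section GramDiagonal

variable {N K : ℕ} {A : Matrix (Fin N) (Fin K) ℝ} {d : Fin N → ℝ}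

theorem linearReceiver_eq_transpose_mul_diagonal (hA : A * Aᵀ = Matrix.diagonal d) {α : ℝ}
    (hα : 0 < α) :
    linearReceiver α A = Aᵀ * Matrix.diagonal fun i => (d i + α)⁻¹ := by
  have hinv : (A * Aᵀ + α • (1 : Matrix (Fin N) (Fin N) ℝ)) *
      Matrix.diagonal (fun i => (d i + α)⁻¹) = 1 := by
    rw [hA, Matrix.smul_one_eq_diagonal, Matrix.diagonal_add, Matrix.diagonal_mul_diagonal,
      ← Matrix.diagonal_one]
    congr with i
    have := nonneg_of_mul_transpose_eq_diagonal hA i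
    exact mul_inv_cancel₀ (by positivity)
  have hpush : (Aᵀ * A + α • (1 : Matrix (Fin K) (Fin K) ℝ)) *
      (Aᵀ * Matrix.diagonal fun i => (d i + α)⁻¹) = Aᵀ := by
    calc _ = Aᵀ * ((A * Aᵀ + α • (1 : Matrix (Fin N) (Fin N) ℝ)) *
          Matrix.diagonal fun i => (d i + α)⁻¹) := by
          simp only [Matrix.add_mul, Matrix.mul_add, Matrix.mul_assoc, Matrix.smul_mul,
            Matrix.mul_smul, Matrix.one_mul]
      _ = Aᵀ := by rw [hinv, Matrix.mul_one]
  have hdet := (Matrix.isUnit_iff_isUnit_det _).mp (isUnit_gram_add_smul_one A hα)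
  rw [linearReceiver]
  nth_rewrite 2 [← hpush]
  exact Matrix.nonsing_inv_mul_cancel_left _ _ hdet

theorem isMoorePenroseInverse_transpose_mul_diagonal (hA : A * Aᵀ = Matrix.diagonal d) :
    IsMoorePenroseInverse A (Aᵀ * Matrix.diagonal fun i => (d i)⁻¹) := by
  have hAX : A * (Aᵀ * Matrix.diagonal fun i => (d i)⁻¹) =
      Matrix.diagonal fun i => d i * (d i)⁻¹ := by
    rw [← Matrix.mul_assoc, hA, Matrix.diagonal_mul_diagonal]
  have hrow {i : Fin N} (hi : d i = 0) (k : Fin K) : A i k = 0 := by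
    rw [eq_sum_sq_of_mul_transpose_eq_diagonal hA,
      Finset.sum_eq_zero_iff_of_nonneg fun _ _ => sq_nonneg _] at hi
    exact pow_eq_zero_iff two_ne_zero |>.mp (hi k (Finset.mem_univ k))
  refine ⟨?_, ?_, ?_, ?_⟩
  · ext i k
    rw [hAX, Matrix.diagonal_mul]
    by_cases hi : d i = 0
    · rw [hrow hi, mul_zero]
    · rw [mul_inv_cancel₀ hi, one_mul]
  · rw [Matrix.mul_assoc, hAX, Matrix.mul_assoc, Matrix.diagonal_mul_diagonal]
    congr with i
    by_cases hi : d i = 0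
    · rw [hi, inv_zero, zero_mul]
    · rw [mul_inv_cancel₀ hi, mul_one]
  · rw [hAX, Matrix.diagonal_transpose]
  · simp only [Matrix.transpose_mul, Matrix.transpose_transpose, Matrix.diagonal_transpose,
      Matrix.mul_assoc]

theorem decorrelator_eq_transpose_mul_diagonal (hA : A * Aᵀ = Matrix.diagonal d) :
    decorrelator A = Aᵀ * Matrix.diagonal fun i => (d i)⁻¹ :=
  IsMoorePenroseInverse.unique (Classical.choose_spec (exists_isMoorePenroseInverse A))
    (isMoorePenroseInverse_transpose_mul_diagonal hA)

end GramDiagonal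

section TimeHopping

variable {N K : ℕ}

/-- The time-hopping sequence with its pulse in chip `q.1`, of polarity `q.2`. -/
def thSeq (q : Fin N × ℤˣ) : Fin N → ℝ := Pi.single q.1 ((q.2 : ℤ) : ℝ)

theorem thSeq_injective : Function.Injective (thSeq (N := N)) := by
  rintro ⟨i, s⟩ ⟨j, t⟩ h
  have hi : ((s : ℤ) : ℝ) = if i = j then ((t : ℤ) : ℝ) else 0 := by
    simpa [thSeq, Pi.single_apply] using congrFun h i
  split_ifs at hi with hij
  · exact Prod.ext hij (Units.ext (Int.cast_injective hi))
  · exact absurd (Int.cast_eq_zero.mp hi) s.ne_zero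

theorem range_thSeq (N : ℕ) : Set.range (thSeq (N := N)) = thSequences N := by
  ext s
  constructor
  · rintro ⟨⟨i, t⟩, rfl⟩
    obtain rfl | rfl := Int.units_eq_one_or t
    · exact ⟨i, Or.inl (by simp [thSeq])⟩
    · exact ⟨i, Or.inr (by simp [thSeq])⟩
  · rintro ⟨i, rfl | rfl⟩
    · exact ⟨(i, 1), by simp [thSeq]⟩
    · exact ⟨(i, -1), by simp [thSeq]⟩

theorem sq_cast_unitsInt (s : ℤˣ) : ((s : ℤ) : ℝ) ^ 2 = 1 := by
  obtain rfl | rfl := Int.units_eq_one_or s <;> simp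

theorem dotProduct_thSeq_sq (q r : Fin N × ℤˣ) :
    (thSeq q ⬝ᵥ thSeq r) ^ 2 = if r.1 = q.1 then 1 else 0 := by
  rw [thSeq, thSeq, single_dotProduct, Pi.single_apply]
  split_ifs with h h'
  · rw [mul_pow, sq_cast_unitsInt, sq_cast_unitsInt, one_mul]
  all_goals grind

theorem uniformOn_thSequences_singleton (q : Fin N × ℤˣ) :
    uniformOn (thSequences N) {thSeq q} = ((2 * N : ℕ) : ℝ≥0∞)⁻¹ := by
  classical
  have himage : thSequences N = ↑(Finset.univ.image (thSeq (N := N))) := by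
    rw [Finset.coe_image, Finset.coe_univ, Set.image_univ, range_thSeq]
  rw [himage, ← Finset.coe_singleton, uniformOn_apply_finset,
    Finset.inter_singleton_of_mem (Finset.mem_image_of_mem _ (Finset.mem_univ _)),
    Finset.card_image_of_injective _ thSeq_injective]
  simp [mul_comm]

theorem uniformOn_thSequences_singleton_of_notMem {s : Fin N → ℝ} (hs : s ∉ thSequences N) :
    uniformOn (thSequences N) {s} = 0 := by
  rw [uniformOn_eq_zero_iff (range_thSeq N ▸ Set.finite_range _), Set.inter_singleton_eq_empty]
  exact hs

/-- The matrix whose columns are the time-hopping sequences with the given pulses. -/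
def thMatrix (p : Fin K → Fin N × ℤˣ) : Matrix (Fin N) (Fin K) ℝ :=
  Matrix.of fun i k => thSeq (p k) i

theorem thMatrix_col (p : Fin K → Fin N × ℤˣ) (k : Fin K) : (thMatrix p).col k = thSeq (p k) := rfl

theorem thMatrix_injective : Function.Injective (thMatrix (N := N) (K := K)) := fun _ _ h =>
  funext fun k => thSeq_injective (congrArg (Matrix.col · k) h)

theorem mem_range_thMatrix {z : Matrix (Fin N) (Fin K) ℝ} (hz : ∀ k, z.col k ∈ thSequences N) :
    z ∈ Set.range (thMatrix (N := N) (K := K)) := by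
  simp_rw [← range_thSeq] at hz
  choose p hp using hz
  exact ⟨p, Matrix.ext fun i k => congrFun (hp k) i⟩

/-- The number of users whose pulse lies in chip `i`. -/
def chipLoad (p : Fin K → Fin N × ℤˣ) (i : Fin N) : ℕ :=
  (Finset.univ.filter fun k => (p k).1 = i).card

theorem chipLoad_pos (p : Fin K → Fin N × ℤˣ) (u : Fin K) : 0 < chipLoad p (p u).1 :=
  Finset.card_pos.mpr ⟨u, Finset.mem_filter.mpr ⟨Finset.mem_univ u, rfl⟩⟩

theorem thMatrix_mul_transpose (p : Fin K → Fin N × ℤˣ) :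
    thMatrix p * (thMatrix p)ᵀ = Matrix.diagonal fun i => (chipLoad p i : ℝ) := by
  ext i j
  have hterm (k : Fin K) : thSeq (p k) i * thSeq (p k) j =
      if i = j then if (p k).1 = i then 1 else 0 else 0 := by
    rw [thSeq, Pi.single_apply, Pi.single_apply]
    split_ifs <;> grind [sq_cast_unitsInt]
  rw [Matrix.mul_apply, Matrix.diagonal_apply]
  simp only [Matrix.transpose_apply, thMatrix, Matrix.of_apply, hterm]
  split_ifs
  · rw [Finset.sum_boole, chipLoad]
  · exact Finset.sum_const_zero

/-- A bank of linear receivers all of whose filters are, on every time-hopping matrix, nonzero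
multiples of the matched filters. -/
def IsScaledMatchedFilter (W : Matrix (Fin N) (Fin K) ℝ → Matrix (Fin K) (Fin N) ℝ) : Prop :=
  ∀ p u, ∃ c : ℝ, c ≠ 0 ∧ W (thMatrix p) u = c • thSeq (p u)

theorem transpose_thMatrix_mul_diagonal (p : Fin K → Fin N × ℤˣ) (d : Fin N → ℝ) (u : Fin K) :
    ((thMatrix p)ᵀ * Matrix.diagonal d) u = d (p u).1 • thSeq (p u) := by
  ext i
  rw [Matrix.mul_diagonal, Pi.smul_apply, smul_eq_mul, mul_comm]
  obtain rfl | hi := eq_or_ne i (p u).1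
  · rfl
  · simp [thMatrix, thSeq, hi]

theorem isScaledMatchedFilter_sumf : IsScaledMatchedFilter (sumf (N := N) (K := K)) := fun p u =>
  ⟨1, one_ne_zero, (one_smul ℝ (thSeq (p u))).symm⟩

theorem isScaledMatchedFilter_linearReceiver {α : ℝ} (hα : 0 < α) :
    IsScaledMatchedFilter (linearReceiver (N := N) (K := K) α) := fun p u => by
  rw [linearReceiver_eq_transpose_mul_diagonal (thMatrix_mul_transpose p) hα]
  exact ⟨_, by positivity, transpose_thMatrix_mul_diagonal p _ u⟩

theorem isScaledMatchedFilter_decorrelator :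
    IsScaledMatchedFilter (decorrelator (N := N) (K := K)) := fun p u => by
  rw [decorrelator_eq_transpose_mul_diagonal (thMatrix_mul_transpose p)]
  have := chipLoad_pos p u
  exact ⟨_, by positivity, transpose_thMatrix_mul_diagonal p _ u⟩

end TimeHopping

section InterferedRate

/-- The mutual information, in bits, of a Gaussian channel at signal-to-noise ratio `γ` with `j`
interferers as strong as the signal. -/
noncomputable def interferedRate (γ : ℝ) (j : ℕ) : ℝ := Real.logb 2 (1 + γ / (j * γ + 1))

variable {γ : ℝ}

theorem interferedRate_nonneg (hγ : 0 ≤ γ) (j : ℕ) : 0 ≤ interferedRate γ j := by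
  refine Real.logb_nonneg one_lt_two (le_add_of_nonneg_right ?_)
  positivity

theorem abs_interferedRate_le (hγ : 0 ≤ γ) (j : ℕ) :
    |interferedRate γ j| ≤ Real.logb 2 (1 + γ) := by
  rw [abs_of_nonneg (interferedRate_nonneg hγ j)]
  refine Real.logb_le_logb_of_le one_lt_two (by positivity) ?_
  gcongr
  exact div_le_self hγ (le_add_of_nonneg_left (by positivity))

theorem summable_poissonTerm (β : ℝ) (hγ : 0 ≤ γ) : Summable (poissonTerm β γ) := by
  refine .of_norm_bounded (((Real.summable_pow_div_factorial |β|).mul_right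
    (Real.exp (-β))).mul_right (Real.logb 2 (1 + γ))) fun k => ?_
  have hnorm : ‖poissonTerm β γ k‖ =
      |β| ^ k / k.factorial * Real.exp (-β) * |interferedRate γ k| := by
    rw [poissonTerm, interferedRate, norm_mul, norm_div, norm_mul, norm_pow, Real.norm_natCast,
      Real.norm_of_nonneg (Real.exp_nonneg _), mul_div_right_comm]
    rfl
  rw [hnorm]
  gcongr
  exact abs_interferedRate_le hγ k

end InterferedRate

section FixedSpreading

variable {N K : ℕ}

/-- The signal-to-interference-plus-noise ratio of user `u` when the receiver `V` is applied to the
channel with spreading matrix `z`. -/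
noncomputable def sinr (En N₀ : ℝ≥0) (V : Matrix (Fin K) (Fin N) ℝ) (z : Matrix (Fin N) (Fin K) ℝ)
    (u : Fin K) : ℝ :=
  (V * z) u u ^ 2 * En /
    (∑ j ∈ Finset.univ.erase u, (V * z) u j ^ 2 * En + ∑ i, V u i ^ 2 * N₀)

theorem map_ofReal_mulVec_received (V : Matrix (Fin K) (Fin N) ℝ) (z : Matrix (Fin N) (Fin K) ℝ)
    (b : Fin K → ℂ) (n : Fin N → ℂ) (u : Fin K) :
    (V.map Complex.ofReal *ᵥ received z b n) u =
      ∑ j, ((V * z) u j : ℂ) * b j + ∑ i, (V u i : ℂ) * n i := by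
  have hmap : V.map Complex.ofReal * z.map Complex.ofReal = (V * z).map Complex.ofReal :=
    (Matrix.map_mul (f := Complex.ofRealHom)).symm
  rw [received, Matrix.mulVec_add, Matrix.mulVec_mulVec, hmap]
  rfl

theorem univ_erase_inl {ι κ : Type*} [Fintype ι] [Fintype κ] [DecidableEq ι] [DecidableEq κ]
    (u : ι) : (Finset.univ : Finset (ι ⊕ κ)).erase (.inl u) =
      (Finset.univ.erase u).disjSum Finset.univ := by
  ext (i | j) <;> simp

theorem mutualInfo_received {Ω : Type*} [MeasurableSpace Ω] {μ : Measure Ω} {En N₀ : ℝ≥0}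
    {b : Ω → Fin K → ℂ} {n : Ω → Fin N → ℂ}
    (hbn : HasLaw (fun ω => (b ω, n ω)) ((Measure.pi fun _ => complexGaussian En).prod
      (Measure.pi fun _ => complexGaussian N₀)) μ) (hN₀ : N₀ ≠ 0)
    {V : Matrix (Fin K) (Fin N) ℝ} {u : Fin K} (hV : V u ≠ 0) (z : Matrix (Fin N) (Fin K) ℝ) :
    mutualInfo (fun ω => b ω u)
      (fun ω => (V.map Complex.ofReal *ᵥ received z (b ω) (n ω)) u) μ =
      ENNReal.ofReal (Real.logb 2 (1 + sinr En N₀ V z u)) := by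
  let v : Fin K ⊕ Fin N → ℝ≥0 := Sum.elim (fun _ => En) fun _ => N₀
  let a : Fin K ⊕ Fin N → ℂ := Sum.elim (fun j => ((V * z) u j : ℂ)) fun i => (V u i : ℂ)
  have hpi : HasLaw (fun ω => Sum.elim (b ω) (n ω)) (Measure.pi fun j => complexGaussian (v j)) μ :=
    hasLaw_sumElim hbn
  have hpower : ∑ j ∈ Finset.univ.erase (.inl u), ‖a j‖₊ ^ 2 * v j ≠ 0 := by
    obtain ⟨i, hi⟩ := Function.ne_iff.mp hV
    have hgain : 0 < ‖a (.inr i)‖₊ ^ 2 * v (.inr i) :=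
      mul_pos (pow_pos (nnnorm_pos.mpr (Complex.ofReal_ne_zero.mpr hi)) 2) (pos_of_ne_zero hN₀)
    exact (Finset.sum_pos' (fun _ _ => by positivity)
      ⟨.inr i, Finset.mem_erase.mpr ⟨Sum.inr_ne_inl, Finset.mem_univ _⟩, hgain⟩).ne'
  have hinfo := mutualInfo_linearCombination (iIndepFun_of_hasLaw_pi hpi)
    (hasLaw_eval_of_hasLaw_pi hpi) a (.inl u) hpower
  rw [univ_erase_inl, Finset.sum_disjSum] at hinfo
  simp only [Fintype.sum_sum_type] at hinfo
  simpa [map_ofReal_mulVec_received, sinr, a, v] using hinfo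

end FixedSpreading

section TimeHoppingSinr

variable {N K : ℕ}

/-- The number of other users whose pulse lies in the chip used by user `u`. -/
def interferers (p : Fin K → Fin N × ℤˣ) (u : Fin K) : ℕ :=
  ((Finset.univ.erase u).filter fun j => (p j).1 = (p u).1).card

theorem dotProduct_thSeq_self (q : Fin N × ℤˣ) : thSeq q ⬝ᵥ thSeq q = 1 := by
  rw [thSeq, single_dotProduct, Pi.single_eq_same, ← pow_two, sq_cast_unitsInt]

theorem thSeq_ne_zero (q : Fin N × ℤˣ) : thSeq q ≠ 0 := fun h => by
  simpa [h] using dotProduct_thSeq_self q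

theorem sq_mul_thMatrix_of_eq_smul {V : Matrix (Fin K) (Fin N) ℝ} {p : Fin K → Fin N × ℤˣ}
    {u : Fin K} {c : ℝ} (hV : V u = c • thSeq (p u)) (j : Fin K) :
    (V * thMatrix p) u j ^ 2 = if (p j).1 = (p u).1 then c ^ 2 else 0 := by
  have hcorr : (V * thMatrix p) u j = c * (thSeq (p u) ⬝ᵥ thSeq (p j)) := by
    rw [← smul_eq_mul, ← smul_dotProduct, ← hV]
    rfl
  rw [hcorr, mul_pow, dotProduct_thSeq_sq, mul_ite, mul_one, mul_zero]

theorem sinr_thMatrix_of_eq_smul (En : ℝ≥0) {N₀ : ℝ≥0} (hN₀ : N₀ ≠ 0)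
    {V : Matrix (Fin K) (Fin N) ℝ} {p : Fin K → Fin N × ℤˣ} {u : Fin K} {c : ℝ} (hc : c ≠ 0)
    (hV : V u = c • thSeq (p u)) :
    sinr En N₀ V (thMatrix p) u = (En / N₀ : ℝ) / (interferers p u * (En / N₀) + 1) := by
  have hinterference : ∑ j ∈ Finset.univ.erase u, (V * thMatrix p) u j ^ 2 * En =
      interferers p u * (c ^ 2 * En) := by
    simp_rw [sq_mul_thMatrix_of_eq_smul hV, ite_mul, zero_mul]
    rw [← Finset.sum_filter, Finset.sum_const, nsmul_eq_mul, interferers]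
  have hnoise : ∑ i, V u i ^ 2 * N₀ = c ^ 2 * N₀ := by
    have hgain : V u ⬝ᵥ V u = c ^ 2 := by
      rw [hV, smul_dotProduct, dotProduct_smul, dotProduct_thSeq_self, smul_eq_mul, smul_eq_mul,
        mul_one, pow_two]
    rw [← Finset.sum_mul, ← hgain, dotProduct]
    simp only [pow_two]
  rw [sinr, hinterference, hnoise, sq_mul_thMatrix_of_eq_smul hV, if_pos rfl]
  have : (0 : ℝ) < N₀ := by positivity
  field_simp

end TimeHoppingSinr

section Interferers

variable {N K : ℕ}

theorem interferers_eq_card_filter_subtype (p : Fin K → Fin N × ℤˣ) (u : Fin K) :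
    interferers p u =
      (Finset.univ.filter fun j : {j // j ≠ u} => (p j).1 = (p u).1).card := by
  rw [interferers, ← Finset.filter_ne', Finset.filter_comm, ← Finset.card_subtype]
  congr 1
  ext j
  simp

theorem card_filter_fst_eq {α β : Type*} [Fintype α] [DecidableEq α] [Fintype β] (a : α) :
    (Finset.univ.filter fun q : α × β => q.1 = a).card = Fintype.card β := by
  have hproduct : (Finset.univ.filter fun q : α × β => q.1 = a) = {a} ×ˢ Finset.univ := by
    ext q
    simp only [Finset.mem_filter_univ, Finset.mem_product, Finset.mem_singleton, Finset.mem_univ,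
      and_true]
  rw [hproduct, Finset.card_product, Finset.card_singleton, one_mul, Finset.card_univ]

theorem average_apply_interferers (hN : 0 < N) (u : Fin K) (F : ℕ → ℝ) :
    (2 * N : ℝ)⁻¹ ^ K * ∑ p : Fin K → Fin N × ℤˣ, F (interferers p u) =
      ∑' k, binomialWeight (K - 1) (N : ℝ)⁻¹ k * F k := by
  have : NeZero N := ⟨hN.ne'⟩
  have hcard : Fintype.card {j // j ≠ u} = K - 1 := by simp
  have hcardX : (Fintype.card (Fin N × ℤˣ) : ℝ) = 2 * N := by simp [mul_comm]
  have hchip (q : Fin N × ℤˣ) := average_apply_card_filter (κ := {j // j ≠ u})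
    (fun r : Fin N × ℤˣ => r.1 = q.1) F
  simp only [card_filter_fst_eq, Fintype.card_units_int, hcard, hcardX, Nat.cast_ofNat,
    div_mul_cancel_left₀ (two_ne_zero (α := ℝ))] at hchip
  have hsplit : ∑ p : Fin K → Fin N × ℤˣ, F (interferers p u) =
      ∑ q : Fin N × ℤˣ, ∑ g : {j // j ≠ u} → Fin N × ℤˣ,
        F (Finset.univ.filter fun j => (g j).1 = q.1).card := by
    simp only [interferers_eq_card_filter_subtype]
    rw [← Fintype.sum_prod_type']
    exact (Equiv.funSplitAt u (Fin N × ℤˣ)).sum_comp fun r =>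
      F (Finset.univ.filter fun j => (r.2 j).1 = r.1.1).card
  have hpow : (2 * N : ℝ)⁻¹ ^ K = (2 * N : ℝ)⁻¹ * (2 * N : ℝ)⁻¹ ^ (K - 1) :=
    (mul_pow_sub_one (Fin.pos u).ne' _).symm
  rw [hsplit, hpow, mul_assoc, Finset.mul_sum, Finset.sum_congr rfl fun q _ => hchip q,
    Finset.sum_const, Finset.card_univ, nsmul_eq_mul, hcardX,
    inv_mul_cancel_left₀ (by positivity)]

end Interferers

theorem setOf_eq_preimage_col {Ω : Type*} {N K : ℕ} (S : Ω → Matrix (Fin N) (Fin K) ℝ)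
    (z : Matrix (Fin N) (Fin K) ℝ) :
    {ω | S ω = z} = (fun ω k => (S ω).col k) ⁻¹' {fun k => z.col k} := by
  ext ω
  exact ⟨fun h => congrArg (fun A k => Matrix.col A k) h,
    fun h => Matrix.ext fun i k => congrFun (congrFun h k) i⟩

section Channel

variable {Ω : Type*} [MeasurableSpace Ω] {μ : Measure Ω} {N K : ℕ}
  {En N₀ : ℝ≥0} {S : Ω → Matrix (Fin N) (Fin K) ℝ} {b : Ω → Fin K → ℂ} {n : Ω → Fin N → ℂ}

theorem IsTHChannel.hasLaw_cols (h : IsTHChannel μ En N₀ S b n) :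
    HasLaw (fun ω k => (S ω).col k) (Measure.pi fun _ => uniformOn (thSequences N)) μ :=
  h.indep_col.hasLaw_pi h.law_col

theorem IsTHChannel.measure_eq (h : IsTHChannel μ En N₀ S b n) (z : Matrix (Fin N) (Fin K) ℝ) :
    μ {ω | S ω = z} = ∏ k, uniformOn (thSequences N) {z.col k} := by
  rw [setOf_eq_preimage_col, ← Measure.map_apply_of_aemeasurable h.hasLaw_cols.aemeasurable
    (measurableSet_singleton _), h.hasLaw_cols.map_eq, Measure.pi_singleton]

theorem IsTHChannel.measure_eq_thMatrix (h : IsTHChannel μ En N₀ S b n)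
    (p : Fin K → Fin N × ℤˣ) : μ {ω | S ω = thMatrix p} = ((2 * N : ℕ) : ℝ≥0∞)⁻¹ ^ K := by
  simp_rw [h.measure_eq, thMatrix_col, uniformOn_thSequences_singleton]
  rw [Finset.prod_const, Finset.card_univ, Fintype.card_fin]

theorem IsTHChannel.measure_eq_of_notMem_range (h : IsTHChannel μ En N₀ S b n)
    {z : Matrix (Fin N) (Fin K) ℝ} (hz : z ∉ Set.range (thMatrix (N := N) (K := K))) :
    μ {ω | S ω = z} = 0 := by
  obtain ⟨k, hk⟩ := not_forall.mp (mt mem_range_thMatrix hz)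
  rw [h.measure_eq]
  exact Finset.prod_eq_zero (Finset.mem_univ k) (uniformOn_thSequences_singleton_of_notMem hk)

theorem IsTHChannel.hasLaw_input_noise_cond (h : IsTHChannel μ En N₀ S b n)
    {z : Matrix (Fin N) (Fin K) ℝ} (hz : μ {ω | S ω = z} ≠ 0) :
    HasLaw (fun ω => (b ω, n ω)) ((Measure.pi fun _ => complexGaussian En).prod
      (Measure.pi fun _ => complexGaussian N₀)) (μ[|{ω | S ω = z}]) := by
  have := h.indep_col.isProbabilityMeasure
  rw [setOf_eq_preimage_col] at hz ⊢
  exact hasLaw_cond_of_indepFun h.indep_spreading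
    (h.indep_input_noise.hasLaw_prod h.law_input h.law_noise) (measurableSet_singleton _) hz

theorem IsTHChannel.ae_cond_eq (h : IsTHChannel μ En N₀ S b n) (z : Matrix (Fin N) (Fin K) ℝ) :
    ∀ᵐ ω ∂(μ[|{ω | S ω = z}]), S ω = z := by
  refine ae_cond_mem₀ (s := {ω | S ω = z}) ?_
  rw [setOf_eq_preimage_col]
  exact h.hasLaw_cols.aemeasurable.nullMeasurableSet_preimage (measurableSet_singleton _)

theorem IsTHChannel.mutualInfo_cond (h : IsTHChannel μ En N₀ S b n) (hN₀ : N₀ ≠ 0)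
    (W : Matrix (Fin N) (Fin K) ℝ → Matrix (Fin K) (Fin N) ℝ) {u : Fin K}
    {z : Matrix (Fin N) (Fin K) ℝ} (hz : μ {ω | S ω = z} ≠ 0) (hW : W z u ≠ 0) :
    mutualInfo (fun ω => b ω u)
      (fun ω => ((W (S ω)).map Complex.ofReal *ᵥ received (S ω) (b ω) (n ω)) u)
      (μ[|{ω | S ω = z}]) = ENNReal.ofReal (Real.logb 2 (1 + sinr En N₀ (W z) z u)) := by
  rw [← mutualInfo_received (h.hasLaw_input_noise_cond hz) hN₀ hW z]
  refine mutualInfo_congr_right ?_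
  filter_upwards [h.ae_cond_eq z] with ω hω
  rw [hω]

theorem IsTHChannel.userInfo_eq_sum (h : IsTHChannel μ En N₀ S b n) (hN₀ : N₀ ≠ 0)
    {W : Matrix (Fin N) (Fin K) ℝ → Matrix (Fin K) (Fin N) ℝ} (hW : IsScaledMatchedFilter W)
    (u : Fin K) :
    userInfo μ W S b n u = ∑ p : Fin K → Fin N × ℤˣ, ((2 * N : ℕ) : ℝ≥0∞)⁻¹ ^ K *
      ENNReal.ofReal (interferedRate (En / N₀) (interferers p u)) := by
  have hsupport : Function.support (fun z => μ {ω | S ω = z} * mutualInfo (fun ω => b ω u)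
      (fun ω => ((W (S ω)).map Complex.ofReal *ᵥ received (S ω) (b ω) (n ω)) u)
      (μ[|{ω | S ω = z}])) ⊆ Set.range thMatrix :=
    Function.support_subset_iff'.mpr fun z hz => by
      rw [h.measure_eq_of_notMem_range hz, zero_mul]
  rw [userInfo, condMutualInfo, ← thMatrix_injective.tsum_eq hsupport, tsum_fintype]
  refine Finset.sum_congr rfl fun p _ => ?_
  obtain ⟨c, hc, hcW⟩ := hW p u
  have hp := h.measure_eq_thMatrix p
  rw [h.mutualInfo_cond hN₀ W (hp ▸ pow_ne_zero _ (by simp [ENNReal.mul_eq_top]))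
    (hcW ▸ smul_ne_zero hc (thSeq_ne_zero _)), sinr_thMatrix_of_eq_smul En hN₀ hc hcW, hp,
    interferedRate]

theorem IsTHChannel.userInfo_eq_tsum (h : IsTHChannel μ En N₀ S b n) (hN : 0 < N) (hN₀ : N₀ ≠ 0)
    {W : Matrix (Fin N) (Fin K) ℝ → Matrix (Fin K) (Fin N) ℝ} (hW : IsScaledMatchedFilter W)
    (u : Fin K) :
    userInfo μ W S b n u = ENNReal.ofReal
      (∑' k, binomialWeight (K - 1) (N : ℝ)⁻¹ k * interferedRate (En / N₀) k) := by
  have hinv : ((2 * N : ℕ) : ℝ≥0∞)⁻¹ = ENNReal.ofReal (2 * N : ℝ)⁻¹ := by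
    rw [ENNReal.ofReal_inv_of_pos (by positivity), ← ENNReal.ofReal_natCast]
    push_cast
    rfl
  rw [h.userInfo_eq_sum hN₀ hW u, hinv, ← Finset.mul_sum, ← ENNReal.ofReal_sum_of_nonneg fun p _ =>
      interferedRate_nonneg (by positivity) (interferers p u),
    ← ENNReal.ofReal_pow (by positivity), ← ENNReal.ofReal_mul (by positivity),
    average_apply_interferers hN]

end Channel

theorem tendsto_natCast_sub_one_mul_inv {ι : Type*} {l : Filter ι} {N K : ι → ℕ} {β : ℝ}
    (hN : Tendsto N l atTop) (hK : Tendsto (fun i => (K i : ℝ) / N i) l (𝓝 β))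
    (hpos : ∀ i, 0 < K i) :
    Tendsto (fun i => ((K i - 1 : ℕ) : ℝ) * (N i : ℝ)⁻¹) l (𝓝 β) := by
  have h := hK.sub (tendsto_inv_atTop_nhds_zero_nat.comp hN)
  rw [sub_zero] at h
  refine h.congr fun i => ?_
  rw [Nat.cast_pred (hpos i), Function.comp_apply]
  ring

theorem tendsto_userInfo {β : ℝ} (hβ : 0 ≤ β) {En N₀ : ℝ≥0} (hN₀ : N₀ ≠ 0) {ι : Type*}
    {l : Filter ι} {N K : ι → ℕ} (hN : Tendsto N l atTop)
    (hK : Tendsto (fun i => (K i : ℝ) / N i) l (𝓝 β))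
    {Ω : ι → Type*} [∀ i, MeasurableSpace (Ω i)] {μ : ∀ i, Measure (Ω i)}
    {S : ∀ i, Ω i → Matrix (Fin (N i)) (Fin (K i)) ℝ}
    {b : ∀ i, Ω i → Fin (K i) → ℂ} {n : ∀ i, Ω i → Fin (N i) → ℂ}
    (hch : ∀ i, IsTHChannel (μ i) En N₀ (S i) (b i) (n i)) (u : ∀ i, Fin (K i))
    {W : ∀ i, Matrix (Fin (N i)) (Fin (K i)) ℝ → Matrix (Fin (K i)) (Fin (N i)) ℝ}
    (hW : ∀ i, IsScaledMatchedFilter (W i)) :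
    Tendsto (fun i => ENNReal.ofReal β * userInfo (μ i) (W i) (S i) (b i) (n i) (u i)) l
      (𝓝 (ENNReal.ofReal (β * ∑' k, poissonTerm β (En / N₀) k))) := by
  have hmean := tendsto_natCast_sub_one_mul_inv hN hK fun i => Fin.pos (u i)
  have hrate := tendsto_tsum_binomialWeight_mul
    (abs_interferedRate_le (γ := En / N₀) (by positivity)) hmean
    (tendsto_inv_atTop_nhds_zero_nat.comp hN) (.of_forall fun i => by positivity)
  refine (ENNReal.tendsto_ofReal (hrate.const_mul β)).congr' ?_
  filter_upwards [hN.eventually_gt_atTop 0] with i hi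
  rw [(hch i).userInfo_eq_tsum hi hN₀ (hW i) (u i), ENNReal.ofReal_mul hβ]

end THCDMA

theorem theorem5
    (β : ℝ) (hβ : 0 < β) (En N₀ : ℝ≥0) (hEn : 0 < En) (hN₀ : 0 < N₀)
    (γ : ℝ) (hγ : γ = (En : ℝ) / (N₀ : ℝ))
    -- the large-system limit: `N → ∞` and `K / N → β`
    (N K : ℕ → ℕ) (hN : Tendsto N atTop atTop)
    (hK : Tendsto (fun m => (K m : ℝ) / (N m : ℝ)) atTop (𝓝 β))
    {Ω : ℕ → Type*} [∀ m, MeasurableSpace (Ω m)]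
    (μ : ∀ m, Measure (Ω m)) [∀ m, IsProbabilityMeasure (μ m)]
    (S : ∀ m, Ω m → Matrix (Fin (N m)) (Fin (K m)) ℝ)
    (b : ∀ m, Ω m → Fin (K m) → ℂ) (n : ∀ m, Ω m → Fin (N m) → ℂ)
    (hch : ∀ m, THCDMA.IsTHChannel (μ m) En N₀ (S m) (b m) (n m))
    -- the user under consideration
    (u : ∀ m, Fin (K m)) :
    Summable (THCDMA.poissonTerm β γ) ∧
    -- decorrelators
    Tendsto (fun m => ENNReal.ofReal β *
        THCDMA.userInfo (μ m) THCDMA.decorrelator (S m) (b m) (n m) (u m)) atTop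
      (𝓝 (ENNReal.ofReal (β * ∑' k, THCDMA.poissonTerm β γ k))) ∧
    -- MMSE filters
    Tendsto (fun m => ENNReal.ofReal β *
        THCDMA.userInfo (μ m) (THCDMA.mmse γ) (S m) (b m) (n m) (u m)) atTop
      (𝓝 (ENNReal.ofReal (β * ∑' k, THCDMA.poissonTerm β γ k))) ∧
    -- the same value for every regularization parameter
    (∀ α : ℝ, 0 < α →
      Tendsto (fun m => ENNReal.ofReal β *
          THCDMA.userInfo (μ m) (THCDMA.linearReceiver α) (S m) (b m) (n m) (u m)) atTop
        (𝓝 (ENNReal.ofReal (β * ∑' k, THCDMA.poissonTerm β γ k)))) ∧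
    -- the same value for single-user matched filters
    Tendsto (fun m => ENNReal.ofReal β *
        THCDMA.userInfo (μ m) THCDMA.sumf (S m) (b m) (n m) (u m)) atTop
      (𝓝 (ENNReal.ofReal (β * ∑' k, THCDMA.poissonTerm β γ k))) := by
  have hγ0 : 0 < γ := hγ ▸ div_pos (NNReal.coe_pos.mpr hEn) (NNReal.coe_pos.mpr hN₀)
  have hlin (α : ℝ) (hα : 0 < α) :
      Tendsto (fun m => ENNReal.ofReal β *
          THCDMA.userInfo (μ m) (THCDMA.linearReceiver α) (S m) (b m) (n m) (u m)) atTop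
        (𝓝 (ENNReal.ofReal (β * ∑' k, THCDMA.poissonTerm β γ k))) :=
    hγ ▸ THCDMA.tendsto_userInfo hβ.le hN₀.ne' hN hK hch u
      fun _ => THCDMA.isScaledMatchedFilter_linearReceiver hα
  exact ⟨THCDMA.summable_poissonTerm β hγ0.le,
    hγ ▸ THCDMA.tendsto_userInfo hβ.le hN₀.ne' hN hK hch u
      fun _ => THCDMA.isScaledMatchedFilter_decorrelator,
    hlin (1 / γ) (one_div_pos.mpr hγ0), hlin,
    hγ ▸ THCDMA.tendsto_userInfo hβ.le hN₀.ne' hN hK hch u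
      fun _ => THCDMA.isScaledMatchedFilter_sumf⟩
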